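/- Let $n\ge 1$ and work over $\mathbb{C}$. A rational normal curve in $\mathbb{P}^n$ is a curve $\mathcal{C}\subset\mathbb{P}^n$ that spans $\mathbb{P}^n$ and is the image of a linearly normal embedding of $\mathbb{P}^1$; that is, $\mathcal{C}$ is the image of a map $\mathbb{P}^1\to\mathbb{P}^n$, $x\mapsto[f_0(x):\dots:f_n(x)]$, where $f_0,\dots,f_n$ is a basis of the space of all binary forms of some degree (necessarily of degree $n$). A codimension-two linear space $\Lambda\subset\mathbb{P}^n$ is $(n-1)$-secant to $\mathcal{C}$ if $\Lambda\cap\mathcal{C}$ is a set of exactly $n-1$ distinct points. Consider in $\mathbb{P}^n$ three points and $n$ codimension-two linear spaces in generic position. Then there exists a unique rational normal curve passing through the three points and $(n-1)$-secant to each of the $n$ linear spaces. Precisely: there is a non-empty Zariski open subset $U$ of the data space $G(n-2,\mathbb{P}^n)^n\times(\mathbb{P}^n)^3$ such that for every $(\Lambda_1,\dots,\Lambda_n,P_1,P_2,P_3)\in U$ there is exactly one rational normal curve $\mathcal{C}\subset\mathbb{P}^n$ with $P_1,P_2,P_3\in\mathcal{C}$ that is $(n-1)$-secant to every $\Lambda_i$.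 (For $n=1$ a codimension-two linear space is empty.) -/

import Mathlib

namespace RationalNormal

/-- Complex projective space of dimension `n`. -/
abbrev ProjSpace (n : ℕ) : Type := Projectivization ℂ (Fin (n + 1) → ℂ)

/-- The Grassmannian of codimension two linear subspaces of projective `n`-space: linear
subspaces of `ℂ^(n+1)` of vector space codimension two. -/
def CodimTwo (n : ℕ) : Type :=
  {W : Submodule ℂ (Fin (n + 1) → ℂ) // Module.finrank ℂ W + 2 = n + 1}

/-- The set of points of projective space lying on a codimension two linear space. -/
def CodimTwo.points {n : ℕ} (L : CodimTwo n) : Set (ProjSpace n) :=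
  {P | P.submodule ≤ L.1}

/-- A rational normal curve in projective `n`-space, as a set of points: the image of the
projective line under a map `x ↦ [f₀ x : ⋯ : fₙ x]`, where the `fᵢ` are binary forms of one
degree `d` which are linearly independent (the curve spans the space) and which span the space
of all binary forms of degree `d` (the curve is linearly normal, that is, the linear system that
defines the map is complete). -/
def IsRationalNormalCurve {n : ℕ} (C : Set (ProjSpace n)) : Prop :=
  ∃ (d : ℕ) (f : Fin (n + 1) → MvPolynomial (Fin 2) ℂ),
    LinearIndependent ℂ f ∧
    Submodule.span ℂ (Set.range f) = MvPolynomial.homogeneousSubmodule (Fin 2) ℂ d ∧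
    C = {P | ∃ x : Fin 2 → ℂ, x ≠ 0 ∧
      ∃ h : (fun i => MvPolynomial.eval x (f i)) ≠ 0,
        P = Projectivization.mk ℂ (fun i => MvPolynomial.eval x (f i)) h}

/-- The codimension two linear space `L` is `(n-1)`-secant to `C`: they meet in a set of exactly
`n - 1` distinct points. -/
def IsSecant {n : ℕ} (C : Set (ProjSpace n)) (L : CodimTwo n) : Prop :=
  (L.points ∩ C).encard = ((n - 1 : ℕ) : ℕ∞)

/-- The data space: `l` codimension two linear spaces and `p` points in projective `n`-space. -/
abbrev Datum (n l p : ℕ) : Type := (Fin l → CodimTwo n) × (Fin p → ProjSpace n)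

/-- The homogeneous coordinates of a datum: the coefficients of two linear equations for each of
the linear spaces, and the homogeneous coordinates of each of the points. -/
abbrev Coord (n l p : ℕ) : Type := (Fin l × Fin 2 × Fin (n + 1)) ⊕ (Fin p × Fin (n + 1))

/-- `c` is a system of homogeneous coordinates of the datum `δ`: each linear space is the zero
locus of its two equations, and each point is the class of its coordinate vector. -/
def Represents {n l p : ℕ} (c : Coord n l p → ℂ) (δ : Datum n l p) : Prop :=
  (∀ i : Fin l, ∀ x : Fin (n + 1) → ℂ,
      x ∈ (δ.1 i).1 ↔ ∀ r : Fin 2, ∑ k, c (Sum.inl (i, r, k)) * x k = 0) ∧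
  (∀ j : Fin p, ∃ h : (fun k => c (Sum.inr (j, k))) ≠ 0,
      δ.2 j = Projectivization.mk ℂ (fun k => c (Sum.inr (j, k))) h)

/-- Zariski open subsets of the data space, a product of Grassmannians and projective spaces: the
topology is the quotient of the Zariski topology on systems of homogeneous coordinates, so `U` is
open when the systems of coordinates of its members are cut out, among all systems of coordinates
of data, by the non-vanishing of at least one of a set of polynomials. -/
def IsZariskiOpen {n l p : ℕ} (U : Set (Datum n l p)) : Prop :=
  ∃ S : Set (MvPolynomial (Coord n l p) ℂ),
    ∀ (δ : Datum n l p) (c : Coord n l p → ℂ), Represents c δ →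
      (δ ∈ U ↔ ∃ q ∈ S, MvPolynomial.eval c q ≠ 0)

/-- A property holds for data in generic position if it holds for all members of some non-empty
Zariski open subset of the (irreducible) data space. -/
def HoldsGenerically {n l p : ℕ} (Q : Datum n l p → Prop) : Prop :=
  ∃ U : Set (Datum n l p), IsZariskiOpen U ∧ U.Nonempty ∧ ∀ δ ∈ U, Q δ

end RationalNormal

/-! This is Steiner's construction. In the pencil of hyperplanes containing `Λᵢ`, let `aᵢ` pass
through `p₀` and `bᵢ` through `p₁`, scaled to agree at `p₂`. The equations `t aᵢ = s bᵢ` are `n`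
linear equations in `n + 1` unknowns, solved by the maximal minors, which are binary forms of degree
`n` in `[s : t]`. When these forms are a basis, their curve contains `p₀, p₁, p₂` at the parameters
`0, ∞, 1`. Along it `aᵢ = s ρᵢ` and `bᵢ = t ρᵢ` with `ρᵢ` of degree `n - 1`, and the zeros of `ρᵢ`
are the points on `Λᵢ` (`IsGenericFrame.isSecant`).

Uniqueness is a zero count. On any curve with the required incidences, the pencils pull back to
forms of degree `n`. A suitable combination of `aᵢ` and `bᵢ` has degree `n + 1` and vanishes at the
`n - 1` secant points and the three given points, so it is zero (`cross_mul_eq`). Hence, up to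
reparametrization, the curve satisfies the same equations `t aᵢ = s bᵢ` (`curveOf_eq`).

The conditions used are the non-vanishing of one polynomial, `genericity`. It does not depend on the
coordinates chosen (`genericity_ne_zero_of_represents`), and an explicit diagonal example shows that
it is not identically zero. -/

namespace RationalNormal

/-! ### Binary forms and their zeros -/

section BinaryForms

open MvPolynomial

/-- The exponent of the `j`-th monomial of degree `d` in two variables. -/
noncomputable def binaryExponent (d : ℕ) (j : Fin (d + 1)) : Fin 2 →₀ ℕ :=
  Finsupp.single 0 j.1 + Finsupp.single 1 j.rev.1

theorem binaryExponent_injective (d : ℕ) : Function.Injective (binaryExponent d) := by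
  intro i j h
  have := DFunLike.congr_fun h 0
  simpa [binaryExponent, Fin.ext_iff] using this

theorem linearIndependent_binaryMonomials (d : ℕ) :
    LinearIndependent ℂ
      (fun j : Fin (d + 1) => (monomial (binaryExponent d j) 1 : MvPolynomial (Fin 2) ℂ)) := by
  have := (basisMonomials (Fin 2) ℂ).linearIndependent.comp _ (binaryExponent_injective d)
  rw [coe_basisMonomials] at this
  exact this

theorem span_binaryMonomials (d : ℕ) :
    Submodule.span ℂ (Set.range
      (fun j : Fin (d + 1) => (monomial (binaryExponent d j) 1 : MvPolynomial (Fin 2) ℂ))) =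
      homogeneousSubmodule (Fin 2) ℂ d := by
  apply le_antisymm
  · rw [Submodule.span_le]
    rintro _ ⟨j, rfl⟩
    refine isHomogeneous_monomial _ ?_
    have := j.2
    simp [binaryExponent, Finsupp.degree_eq_sum, Fin.val_rev]
    omega
  · intro G hG
    rw [G.as_sum]
    refine Submodule.sum_mem _ fun m hm => ?_
    have hd := hG (mem_support_iff.1 hm)
    have hd' : m 0 + m 1 = d := by
      simpa [Finsupp.weight_apply, Finsupp.sum_fintype] using hd
    have : m = binaryExponent d ⟨m 0, by omega⟩ := by
      ext i
      fin_cases i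
      · simp [binaryExponent]
      · simp [binaryExponent, Fin.val_rev]
        omega
    have h2 : monomial m (coeff m G) = coeff m G • (monomial m 1 : MvPolynomial (Fin 2) ℂ) := by
      simp [smul_monomial]
    rw [h2]
    exact Submodule.smul_mem _ _ (Submodule.subset_span ⟨⟨m 0, by omega⟩, congrArg (fun e => monomial e (1 : ℂ)) this.symm⟩)

theorem finrank_binaryForms (d : ℕ) :
    Module.finrank ℂ (homogeneousSubmodule (Fin 2) ℂ d) = d + 1 := by
  rw [← span_binaryMonomials, finrank_span_eq_card (linearIndependent_binaryMonomials d)]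
  simp

theorem exists_coeffs_of_isHomogeneous {d : ℕ} {G : MvPolynomial (Fin 2) ℂ}
    (hG : G.IsHomogeneous d) :
    ∃ w : Fin (d + 1) → ℂ, G = ∑ j, w j • monomial (binaryExponent d j) 1 := by
  have : G ∈ homogeneousSubmodule (Fin 2) ℂ d := hG
  rw [← span_binaryMonomials, Submodule.mem_span_range_iff_exists_fun] at this
  exact this.imp fun _ h => h.symm

theorem eval_binaryMonomial (d : ℕ) (j : Fin (d + 1)) (x : Fin 2 → ℂ) :
    eval x (monomial (binaryExponent d j) 1) = x 0 ^ j.1 * x 1 ^ j.rev.1 := by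
  rw [eval_monomial, Finsupp.prod_fintype _ _ (by simp)]
  simp [binaryExponent]

/-- A binary form of degree `d` with more than `d` zeros on the projective line vanishes. -/
theorem eq_zero_of_isHomogeneous_of_card {d : ℕ} {G : MvPolynomial (Fin 2) ℂ}
    (hG : G.IsHomogeneous d) {ι : Type*} (s : Finset ι) (hs : d + 1 ≤ s.card)
    (x : ι → Fin 2 → ℂ) (hx : ∀ i ∈ s, ∀ j ∈ s, i ≠ j → x i 0 * x j 1 ≠ x j 0 * x i 1)
    (h0 : ∀ i ∈ s, eval (x i) G = 0) : G = 0 := by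
  obtain ⟨w, rfl⟩ := exists_coeffs_of_isHomogeneous hG
  obtain ⟨e⟩ : Nonempty (Fin (d + 1) ↪ s) :=
    Function.Embedding.nonempty_of_card_le (by simpa using hs)
  -- In the monomial basis, evaluation at `d + 1` of the points is a homogeneous Vandermonde matrix.
  have hdet : (Matrix.projVandermonde (fun i => x (e i) 0) (fun i => x (e i) 1)).det ≠ 0 := by
    rw [Matrix.det_projVandermonde, Finset.prod_ne_zero_iff]
    intro i _
    rw [Finset.prod_ne_zero_iff]
    intro j hj
    rw [sub_ne_zero]
    refine (hx _ (e j).2 _ (e i).2 fun h => ?_)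
    have : j = i := e.injective (Subtype.ext h)
    simp [this] at hj
  have hw : w = 0 := by
    refine Matrix.eq_zero_of_mulVec_eq_zero hdet ?_
    ext i
    have := h0 _ (e i).2
    simp only [map_sum, smul_eval, eval_binaryMonomial] at this
    rw [Matrix.mulVec, dotProduct, Pi.zero_apply, ← this]
    exact Finset.sum_congr rfl fun j _ => by rw [Matrix.projVandermonde_apply, mul_comm]
  simp [hw]

theorem eval_smul_of_isHomogeneous {d : ℕ} {G : MvPolynomial (Fin 2) ℂ}
    (hG : G.IsHomogeneous d) (r : ℂ) (x : Fin 2 → ℂ) :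
    eval (r • x) G = r ^ d * eval x G := by
  obtain ⟨w, rfl⟩ := exists_coeffs_of_isHomogeneous hG
  simp only [map_sum, smul_eval, eval_binaryMonomial, Finset.mul_sum, Pi.smul_apply, smul_eq_mul,
    mul_pow]
  refine Finset.sum_congr rfl fun j _ => ?_
  have : d = j.1 + j.rev.1 := by rw [Fin.val_rev]; have := j.2; omega
  have hr : r ^ d = r ^ j.1 * r ^ j.rev.1 := by rw [← pow_add, ← this]
  rw [hr]
  ring

theorem exists_smul_of_cross_eq {x y : Fin 2 → ℂ} (hy : y ≠ 0) (h : x 0 * y 1 = y 0 * x 1) :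
    ∃ r : ℂ, x = r • y := by
  by_cases h0 : y 0 = 0
  · have h1 : y 1 ≠ 0 := fun h1 => hy (by ext i; fin_cases i <;> simp [h0, h1])
    refine ⟨x 1 / y 1, ?_⟩
    ext i
    fin_cases i
    · simpa [h0, h1] using h
    · simp [h1]
  · refine ⟨x 0 / y 0, ?_⟩
    ext i
    fin_cases i
    · simp [h0]
    · simp only [Fin.mk_one, Fin.isValue, Pi.smul_apply, smul_eq_mul]
      field_simp
      linear_combination -h

end BinaryForms

/-! ### Curves parametrized by a basis of binary forms -/

section Curves

open MvPolynomial

variable {n : ℕ}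

/-- The vector of values of a tuple of binary forms. -/
noncomputable def curveVec (f : Fin (n + 1) → MvPolynomial (Fin 2) ℂ) (x : Fin 2 → ℂ) :
    Fin (n + 1) → ℂ := fun i => eval x (f i)

/-- A basis of the binary forms of degree `n`. -/
structure IsFormBasis (f : Fin (n + 1) → MvPolynomial (Fin 2) ℂ) : Prop where
  linearIndependent : LinearIndependent ℂ f
  isHomogeneous : ∀ i, (f i).IsHomogeneous n

/-- The image of the projective line under a tuple of binary forms. -/
def curveOf (f : Fin (n + 1) → MvPolynomial (Fin 2) ℂ) : Set (ProjSpace n) :=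
  {P | ∃ x : Fin 2 → ℂ, x ≠ 0 ∧ ∃ h : curveVec f x ≠ 0, P = Projectivization.mk ℂ (curveVec f x) h}

theorem IsFormBasis.span_eq {f : Fin (n + 1) → MvPolynomial (Fin 2) ℂ} (hf : IsFormBasis f) :
    Submodule.span ℂ (Set.range f) = homogeneousSubmodule (Fin 2) ℂ n := by
  have hfd : Module.Finite ℂ (homogeneousSubmodule (Fin 2) ℂ n) :=
    Module.finite_of_finrank_pos (by rw [finrank_binaryForms]; omega)
  refine Submodule.eq_of_le_of_finrank_eq ?_ ?_
  · rw [Submodule.span_le]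
    rintro _ ⟨i, rfl⟩
    exact hf.isHomogeneous i
  · rw [finrank_binaryForms, finrank_span_eq_card hf.linearIndependent]
    simp

theorem isRationalNormalCurve_iff (C : Set (ProjSpace n)) :
    IsRationalNormalCurve C ↔ ∃ f, IsFormBasis f ∧ C = curveOf f := by
  constructor
  · rintro ⟨d, f, hf, hspan, hC⟩
    have hd : d = n := by
      have h1 := finrank_span_eq_card hf
      rw [hspan, finrank_binaryForms] at h1
      simpa using h1
    subst hd
    refine ⟨f, ⟨hf, fun i => ?_⟩, hC⟩
    have : f i ∈ homogeneousSubmodule (Fin 2) ℂ d := hspan ▸ Submodule.subset_span ⟨i, rfl⟩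
    exact this
  · rintro ⟨f, hf, hC⟩
    exact ⟨n, f, hf.linearIndependent, hf.span_eq, hC⟩

/-- Every form of degree `n` is a combination of the `f i`, so a relation between two curve vectors
passes to all forms. Well-chosen test forms then give base-point freeness and injectivity. -/
theorem IsFormBasis.eval_eq_mul {f : Fin (n + 1) → MvPolynomial (Fin 2) ℂ} (hf : IsFormBasis f)
    {x y : Fin 2 → ℂ} {c : ℂ} (h : curveVec f x = c • curveVec f y)
    {G : MvPolynomial (Fin 2) ℂ} (hG : G.IsHomogeneous n) : eval x G = c * eval y G := by
  have hG' : G ∈ homogeneousSubmodule (Fin 2) ℂ n := hG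
  rw [← hf.span_eq, Submodule.mem_span_range_iff_exists_fun] at hG'
  obtain ⟨w, rfl⟩ := hG'
  simp only [map_sum, smul_eval, Finset.mul_sum]
  refine Finset.sum_congr rfl fun i _ => ?_
  have := congrFun h i
  simp only [curveVec, Pi.smul_apply, smul_eq_mul] at this
  rw [this]
  ring

theorem IsFormBasis.curveVec_ne_zero {f : Fin (n + 1) → MvPolynomial (Fin 2) ℂ}
    (hf : IsFormBasis f) {x : Fin 2 → ℂ} (hx : x ≠ 0) : curveVec f x ≠ 0 := by
  intro h
  apply hx
  ext i
  have := hf.eval_eq_mul (x := x) (y := x) (c := 0) (by simpa using h)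
    (G := X i ^ n) (by simpa using (isHomogeneous_X ℂ i).pow n)
  simpa using eq_zero_of_pow_eq_zero (by simpa using this : x i ^ n = 0)

/-- The test form is the `n`-th power of the linear form vanishing at `y`; it must then vanish at
`x`, provided `n` is positive. -/
theorem IsFormBasis.cross_eq {f : Fin (n + 1) → MvPolynomial (Fin 2) ℂ}
    (hf : IsFormBasis f) (hn : 1 ≤ n) {x y : Fin 2 → ℂ} {c : ℂ}
    (h : curveVec f x = c • curveVec f y) : x 0 * y 1 = y 0 * x 1 := by
  have hG : ((C (y 1) * X 0 - C (y 0) * X 1 : MvPolynomial (Fin 2) ℂ) ^ n).IsHomogeneous n := by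
    simpa using (((isHomogeneous_C_mul_X (y 1) (0 : Fin 2)).sub
      (isHomogeneous_C_mul_X (y 0) (1 : Fin 2))).pow n)
  have := hf.eval_eq_mul h hG
  have hn' : n ≠ 0 := by omega
  simp [mul_comm (y 1) (y 0), hn'] at this
  linear_combination this

theorem curveVec_smul {f : Fin (n + 1) → MvPolynomial (Fin 2) ℂ}
    (hf : ∀ i, (f i).IsHomogeneous n) (r : ℂ) (x : Fin 2 → ℂ) :
    curveVec f (r • x) = r ^ n • curveVec f x := by
  ext i
  simp [curveVec, eval_smul_of_isHomogeneous (hf i)]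

end Curves

/-! ### Maximal minors and kernels -/

section Minors

variable {n : ℕ}

/-- The signed maximal minors of an `n × (n+1)` matrix. -/
def minors {A : Type*} [CommRing A] (M : Matrix (Fin n) (Fin (n + 1)) A) (k : Fin (n + 1)) : A :=
  (-1) ^ (k : ℕ) * (M.submatrix id k.succAbove).det

/-- Row `i` of the product is the Laplace expansion of a determinant in which row `i` occurs twice.
-/
theorem mulVec_minors {A : Type*} [CommRing A] (M : Matrix (Fin n) (Fin (n + 1)) A) :
    M.mulVec (minors M) = 0 := by
  ext i
  let N : Matrix (Fin (n + 1)) (Fin (n + 1)) A := Matrix.of (Fin.cons (M i) M)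
  have h0 : N.det = 0 := Matrix.det_zero_of_row_eq (i := 0) (j := i.succ) (Fin.succ_ne_zero i).symm
    rfl
  rw [Matrix.det_succ_row_zero] at h0
  rw [Pi.zero_apply, ← h0, Matrix.mulVec, dotProduct]
  refine Finset.sum_congr rfl fun k _ => ?_
  have h1 : N.submatrix Fin.succ k.succAbove = M.submatrix id k.succAbove := rfl
  have h2 : N 0 k = M i k := rfl
  rw [h1, h2, minors]
  ring

theorem map_minors {A B : Type*} [CommRing A] [CommRing B] (φ : A →+* B)
    (M : Matrix (Fin n) (Fin (n + 1)) A) (k : Fin (n + 1)) :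
    φ (minors M k) = minors (M.map φ) k := by
  simp [minors, RingHom.map_det, RingHom.mapMatrix_apply, Matrix.submatrix_map]

theorem minors_mul_rows {A : Type*} [CommRing A] (v : Fin n → A)
    (M : Matrix (Fin n) (Fin (n + 1)) A) (k : Fin (n + 1)) :
    minors (Matrix.of fun i j => v i * M i j) k = (∏ i, v i) * minors M k := by
  have := Matrix.det_mul_column v (M.submatrix id k.succAbove)
  simp only [Matrix.submatrix_apply, id] at this
  simp only [minors]
  rw [mul_left_comm, ← this]
  rfl

/-- The kernel of an `n × (n+1)` matrix of full rank is spanned by its maximal minors. -/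
theorem exists_smul_minors {K : Type*} [Field K] {M : Matrix (Fin n) (Fin (n + 1)) K}
    (hM : minors M ≠ 0) {y : Fin (n + 1) → K} (hy : M.mulVec y = 0) :
    ∃ r : K, y = r • minors M := by
  obtain ⟨k, hk⟩ := Function.ne_iff.1 hM
  rw [Pi.zero_apply] at hk
  refine ⟨y k / minors M k, ?_⟩
  -- The multiple is chosen to kill coordinate `k`; the other coordinates then lie in the kernel of
  -- an invertible square block.
  set z := y - (y k / minors M k) • minors M with hz
  have hzk : z k = 0 := by simp [hz, hk]
  have hMz : M.mulVec z = 0 := by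
    rw [hz, Matrix.mulVec_sub, Matrix.mulVec_smul, mulVec_minors, hy]
    simp
  have hdet : (M.submatrix id k.succAbove).det ≠ 0 := fun h => hk (by simp [minors, h])
  have h1 : (fun j => z (k.succAbove j)) = 0 := by
    refine Matrix.eq_zero_of_mulVec_eq_zero hdet ?_
    ext i
    have := congrFun hMz i
    rw [Matrix.mulVec, dotProduct, Fin.sum_univ_succAbove _ k, hzk, mul_zero, zero_add] at this
    exact this
  have : z = 0 := by
    ext j
    rcases Fin.eq_self_or_eq_succAbove k j with rfl | ⟨i, rfl⟩
    · exact hzk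
    · exact congrFun h1 i
  exact sub_eq_zero.1 this

end Minors

/-! ### Pencils of hyperplanes: naturality and row scaling -/

section Pencils

variable {n : ℕ} {A : Type*} [CommRing A]

/-- The matrix whose rows are the members of given pencils of linear forms at the
parameter `[s : t]`. -/
def pencil (a b : Fin n → Fin (n + 1) → A) (s t : A) : Matrix (Fin n) (Fin (n + 1)) A :=
  Matrix.of fun i k => t * a i k - s * b i k

/-- The maximal minors of a matrix of pencils, as binary forms. -/
noncomputable def pencilForms (a b : Fin n → Fin (n + 1) → A) :
    Fin (n + 1) → MvPolynomial (Fin 2) A :=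
  minors (pencil (fun i k => MvPolynomial.C (a i k)) (fun i k => MvPolynomial.C (b i k))
    (MvPolynomial.X 0) (MvPolynomial.X 1))

/-- The maximal minors of a matrix of pencils in an affine chart of the parameter line. -/
noncomputable def pencilPoly (a b : Fin n → Fin (n + 1) → A) : Fin (n + 1) → Polynomial A :=
  minors (pencil (fun i k => Polynomial.C (a i k)) (fun i k => Polynomial.C (b i k))
    Polynomial.X 1)

/-- The equation, in an affine chart, of the intersection of the curve of maximal minors with the
base locus of the `i`-th pencil. -/
noncomputable def residual (a b : Fin n → Fin (n + 1) → A) (i : Fin n) : Polynomial A :=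
  ∑ k, Polynomial.C (b i k) * pencilPoly a b k

/-- The matrix of coefficients of the maximal minors. -/
noncomputable def coeffMatrix (a b : Fin n → Fin (n + 1) → A) :
    Matrix (Fin (n + 1)) (Fin (n + 1)) A :=
  Matrix.of fun k j => (pencilPoly a b k).coeff j

theorem pencil_map {B : Type*} [CommRing B] (φ : A →+* B) (a b : Fin n → Fin (n + 1) → A)
    (s t : A) : (pencil a b s t).map φ =
      pencil (fun i k => φ (a i k)) (fun i k => φ (b i k)) (φ s) (φ t) := by
  ext i k
  simp [pencil]

theorem isHomogeneous_pencilForms (a b : Fin n → Fin (n + 1) → A) (k : Fin (n + 1)) :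
    (pencilForms a b k).IsHomogeneous n := by
  rw [pencilForms, minors, Matrix.det_apply, Finset.mul_sum]
  refine MvPolynomial.IsHomogeneous.sum _ _ _ fun σ _ => ?_
  have h1 : (∏ i : Fin n, ((pencil (fun i k => MvPolynomial.C (a i k))
      (fun i k => MvPolynomial.C (b i k)) (MvPolynomial.X 0 : MvPolynomial (Fin 2) A)
      (MvPolynomial.X 1)).submatrix id k.succAbove) (σ i) i).IsHomogeneous n := by
    have := MvPolynomial.IsHomogeneous.prod (R := A) Finset.univ
      (fun i : Fin n => ((pencil (fun i k => MvPolynomial.C (a i k))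
      (fun i k => MvPolynomial.C (b i k)) (MvPolynomial.X 0 : MvPolynomial (Fin 2) A)
      (MvPolynomial.X 1)).submatrix id k.succAbove) (σ i) i) (fun _ => 1) fun i _ => by
        simp only [pencil, Matrix.submatrix_apply, Matrix.of_apply, id]
        rw [mul_comm, mul_comm (MvPolynomial.X 0)]
        exact (MvPolynomial.isHomogeneous_C_mul_X _ _).sub (MvPolynomial.isHomogeneous_C_mul_X _ _)
    simpa using this
  have h2 : ((-1) ^ (k : ℕ) : MvPolynomial (Fin 2) A) = MvPolynomial.C ((-1) ^ (k : ℕ)) := by simp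
  rw [h2]
  refine MvPolynomial.IsHomogeneous.C_mul ?_ _
  rcases Int.units_eq_one_or (Equiv.Perm.sign σ) with h | h
  · simpa [h] using h1
  · simpa [h] using h1.neg

theorem eval_pencilForms (a b : Fin n → Fin (n + 1) → A) (x : Fin 2 → A) (k : Fin (n + 1)) :
    MvPolynomial.eval x (pencilForms a b k) = minors (pencil a b (x 0) (x 1)) k := by
  rw [pencilForms, map_minors, pencil_map]
  simp

theorem aeval_pencilForms (a b : Fin n → Fin (n + 1) → A) (k : Fin (n + 1)) :
    MvPolynomial.aeval ![Polynomial.X, 1] (pencilForms a b k) = pencilPoly a b k := by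
  have := map_minors ((MvPolynomial.aeval ![Polynomial.X, 1] :
    MvPolynomial (Fin 2) A →ₐ[A] Polynomial A) : MvPolynomial (Fin 2) A →+* Polynomial A)
    (pencil (fun i k => MvPolynomial.C (a i k)) (fun i k => MvPolynomial.C (b i k))
    (MvPolynomial.X 0) (MvPolynomial.X 1)) k
  rw [pencil_map] at this
  simpa using! this

theorem eval_pencilPoly (a b : Fin n → Fin (n + 1) → A) (s : A) (k : Fin (n + 1)) :
    (pencilPoly a b k).eval s = minors (pencil a b s 1) k := by
  have := map_minors (Polynomial.evalRingHom s) (pencil (fun i k => Polynomial.C (a i k))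
    (fun i k => Polynomial.C (b i k)) Polynomial.X 1) k
  rw [pencil_map] at this
  simpa using! this

theorem natDegree_pencilPoly_le (a b : Fin n → Fin (n + 1) → A) (k : Fin (n + 1)) :
    (pencilPoly a b k).natDegree ≤ n := by
  have h := Polynomial.natDegree_det_X_add_C_le
    (Matrix.of fun i j => - b i (k.succAbove j)) (Matrix.of fun i j => a i (k.succAbove j))
  have h2 : (pencil (fun i k => Polynomial.C (a i k)) (fun i k => Polynomial.C (b i k))
    Polynomial.X 1).submatrix id k.succAbove =
      (Polynomial.X : Polynomial A) • (Matrix.of fun i j => - b i (k.succAbove j)).map Polynomial.C +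
        (Matrix.of fun i j => a i (k.succAbove j)).map Polynomial.C := by
    ext1 i j
    simp [pencil]
    ring
  rw [pencilPoly, minors, h2]
  have h3 : ((-1) ^ (k : ℕ) : Polynomial A) = Polynomial.C ((-1) ^ (k : ℕ)) := by simp
  rw [h3]
  exact (Polynomial.natDegree_C_mul_le _ _).trans (by simpa using h)

theorem map_pencilPoly {B : Type*} [CommRing B] (φ : A →+* B) (a b : Fin n → Fin (n + 1) → A)
    (k : Fin (n + 1)) : (pencilPoly a b k).map φ =
      pencilPoly (fun i k => φ (a i k)) (fun i k => φ (b i k)) k := by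
  have := map_minors (Polynomial.mapRingHom φ) (pencil (fun i k => Polynomial.C (a i k))
    (fun i k => Polynomial.C (b i k)) Polynomial.X 1) k
  rw [pencil_map] at this
  simpa using! this

theorem map_residual {B : Type*} [CommRing B] (φ : A →+* B) (a b : Fin n → Fin (n + 1) → A)
    (i : Fin n) : (residual a b i).map φ =
      residual (fun i k => φ (a i k)) (fun i k => φ (b i k)) i := by
  simp [residual, Polynomial.map_sum, map_pencilPoly]

theorem map_coeffMatrix {B : Type*} [CommRing B] (φ : A →+* B) (a b : Fin n → Fin (n + 1) → A) :
    (coeffMatrix a b).map φ = coeffMatrix (fun i k => φ (a i k)) (fun i k => φ (b i k)) := by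
  ext k j
  simp [coeffMatrix, ← map_pencilPoly]

/-- Rescaling the two members of a pencil by a common factor leaves its parametrization unchanged.
Changes of coordinates of a datum, and the explicit example, reduce to this case. -/
theorem pencilPoly_mul_rows (v : Fin n → A) (a b : Fin n → Fin (n + 1) → A) (k : Fin (n + 1)) :
    pencilPoly (fun i k => v i * a i k) (fun i k => v i * b i k) k =
      Polynomial.C (∏ i, v i) * pencilPoly a b k := by
  rw [pencilPoly, pencilPoly, map_prod, ← minors_mul_rows]
  congr 1
  ext1 i j
  simp [pencil]
  ring

theorem residual_mul_rows (v : Fin n → A) (a b : Fin n → Fin (n + 1) → A) (i : Fin n) :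
    residual (fun i k => v i * a i k) (fun i k => v i * b i k) i =
      Polynomial.C (v i * ∏ j, v j) * residual a b i := by
  simp only [residual, pencilPoly_mul_rows, Finset.mul_sum, Polynomial.C_mul]
  exact Finset.sum_congr rfl fun k _ => by ring

theorem coeffMatrix_mul_rows (v : Fin n → A) (a b : Fin n → Fin (n + 1) → A) :
    coeffMatrix (fun i k => v i * a i k) (fun i k => v i * b i k) =
      (∏ i, v i) • coeffMatrix a b := by
  ext k j
  simp only [coeffMatrix, pencilPoly_mul_rows, Matrix.of_apply, Polynomial.coeff_C_mul,
    Matrix.smul_apply, smul_eq_mul]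

end Pencils

/-! ### Existence: the curve of minors -/

section Frames

variable {n : ℕ}

theorem curveVec_pencilForms (a b : Fin n → Fin (n + 1) → ℂ) (x : Fin 2 → ℂ) :
    curveVec (pencilForms a b) x = minors (pencil a b (x 0) (x 1)) :=
  funext fun k => eval_pencilForms a b x k

theorem mulVec_pencil (a b : Fin n → Fin (n + 1) → ℂ) (s t : ℂ) (y : Fin (n + 1) → ℂ) (i : Fin n) :
    (pencil a b s t).mulVec y i = t * (a i ⬝ᵥ y) - s * (b i ⬝ᵥ y) := by
  simp only [Matrix.mulVec, dotProduct, pencil, Matrix.of_apply, Finset.mul_sum,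
    ← Finset.sum_sub_distrib]
  exact Finset.sum_congr rfl fun k _ => by ring

theorem dotProduct_minors_pencil (a b : Fin n → Fin (n + 1) → ℂ) (s t : ℂ) (i : Fin n) :
    t * (a i ⬝ᵥ minors (pencil a b s t)) = s * (b i ⬝ᵥ minors (pencil a b s t)) := by
  rw [← sub_eq_zero, ← mulVec_pencil, mulVec_minors, Pi.zero_apply]

theorem isFormBasis_pencilForms {a b : Fin n → Fin (n + 1) → ℂ}
    (h : (coeffMatrix a b).det ≠ 0) : IsFormBasis (pencilForms a b) := by
  refine ⟨?_, isHomogeneous_pencilForms a b⟩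
  rw [Fintype.linearIndependent_iff]
  intro w hw
  have h1 : Matrix.vecMul w (coeffMatrix a b) = 0 := by
    ext j
    have := congrArg (fun G => (MvPolynomial.aeval ![Polynomial.X, 1] G : Polynomial ℂ).coeff j) hw
    simpa [Matrix.vecMul, dotProduct, coeffMatrix, aeval_pencilForms] using this
  exact congrFun (Matrix.eq_zero_of_vecMul_eq_zero h h1)

/-- Only the monomial `x₀ ^ d` survives at the point at infinity of the chart; this detects whether
a dehomogenized form has full degree. -/
theorem coeff_aeval_of_isHomogeneous {d : ℕ} {G : MvPolynomial (Fin 2) ℂ}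
    (hG : G.IsHomogeneous d) :
    (MvPolynomial.aeval ![Polynomial.X, 1] G : Polynomial ℂ).coeff d =
      MvPolynomial.eval ![1, 0] G := by
  obtain ⟨w, rfl⟩ := exists_coeffs_of_isHomogeneous hG
  simp only [map_sum, MvPolynomial.smul_eval, eval_binaryMonomial, map_smul,
    Polynomial.finsetSum_coeff, Polynomial.coeff_smul]
  refine Finset.sum_congr rfl fun j _ => ?_
  rw [MvPolynomial.aeval_monomial, Finsupp.prod_fintype _ _ (by simp)]
  have hj := j.2
  by_cases h : j.1 = d
  · simp [binaryExponent, Polynomial.coeff_X_pow, h, Fin.val_rev]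
  · have h1 : d - j.1 ≠ 0 := by omega
    have h2 : d ≠ j.1 := fun h' => h h'.symm
    simp [binaryExponent, Polynomial.coeff_X_pow, h2, Fin.val_rev, h1]

/-- Pencils of hyperplanes with base loci `L i`, normalized with respect to the points `p j`, whose
curve of maximal minors is a rational normal curve. -/
structure IsGenericFrame (L : Fin n → CodimTwo n) (p : Fin 3 → Fin (n + 1) → ℂ)
    (a b : Fin n → Fin (n + 1) → ℂ) : Prop where
  mem_iff : ∀ i x, x ∈ (L i).1 ↔ a i ⬝ᵥ x = 0 ∧ b i ⬝ᵥ x = 0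
  left_zero : ∀ i, a i ⬝ᵥ p 0 = 0
  right_zero : ∀ i, b i ⬝ᵥ p 0 ≠ 0
  left_one : ∀ i, a i ⬝ᵥ p 1 ≠ 0
  right_one : ∀ i, b i ⬝ᵥ p 1 = 0
  left_two : ∀ i, a i ⬝ᵥ p 2 ≠ 0
  right_two : ∀ i, b i ⬝ᵥ p 2 = a i ⬝ᵥ p 2
  det_ne_zero : (coeffMatrix a b).det ≠ 0

namespace IsGenericFrame

variable {L : Fin n → CodimTwo n} {p : Fin 3 → Fin (n + 1) → ℂ} {a b : Fin n → Fin (n + 1) → ℂ}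

/-- A basis of forms has no common zero, so the pencil matrix has full rank at every parameter. -/
theorem minors_ne_zero (h : IsGenericFrame L p a b) {s t : ℂ} (hst : ![s, t] ≠ 0) :
    minors (pencil a b s t) ≠ 0 := by
  have := (isFormBasis_pencilForms h.det_ne_zero).curveVec_ne_zero hst
  rwa [curveVec_pencilForms] at this

/-- A vector in the kernel of the pencil at a parameter represents the corresponding point. -/
theorem mk_eq_of_mulVec (h : IsGenericFrame L p a b) {s t : ℂ} (hst : ![s, t] ≠ 0)
    {y : Fin (n + 1) → ℂ} (hy : y ≠ 0)
    (hk : ∀ i, t * (a i ⬝ᵥ y) = s * (b i ⬝ᵥ y)) :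
    Projectivization.mk ℂ y hy =
      Projectivization.mk ℂ (minors (pencil a b s t)) (h.minors_ne_zero hst) := by
  obtain ⟨r, hr⟩ := exists_smul_minors (h.minors_ne_zero hst) (y := y) (by
    ext i
    rw [mulVec_pencil, Pi.zero_apply, sub_eq_zero, hk])
  rw [Projectivization.mk_eq_mk_iff']
  exact ⟨r, hr.symm⟩

theorem mk_mem_curveOf (h : IsGenericFrame L p a b) {s t : ℂ} (hst : ![s, t] ≠ 0)
    {y : Fin (n + 1) → ℂ} (hy : y ≠ 0)
    (hk : ∀ i, t * (a i ⬝ᵥ y) = s * (b i ⬝ᵥ y)) :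
    Projectivization.mk ℂ y hy ∈ curveOf (pencilForms a b) := by
  refine ⟨![s, t], hst, (isFormBasis_pencilForms h.det_ne_zero).curveVec_ne_zero hst, ?_⟩
  rw [h.mk_eq_of_mulVec hst hy hk]
  congr 1
  rw [curveVec_pencilForms]
  rfl

theorem point_mem (h : IsGenericFrame L p a b) (hp : ∀ j, p j ≠ 0) (j : Fin 3) :
    Projectivization.mk ℂ (p j) (hp j) ∈ curveOf (pencilForms a b) := by
  fin_cases j
  · exact h.mk_mem_curveOf (s := 0) (t := 1) (by simp) (hp 0) (by simp [h.left_zero])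
  · exact h.mk_mem_curveOf (s := 1) (t := 0) (by simp) (hp 1) (by simp [h.right_one])
  · exact h.mk_mem_curveOf (s := 1) (t := 1) (by simp) (hp 2) (by simp [h.right_two])

/-- The point of the curve at infinity is `p 1`, which lies off the hyperplane `a i`. -/
theorem left_dot_infty (h : IsGenericFrame L p a b) (i : Fin n) :
    a i ⬝ᵥ minors (pencil a b 1 0) ≠ 0 := by
  obtain ⟨r, hr⟩ := exists_smul_minors (h.minors_ne_zero (s := 1) (t := 0) (by simp)) (y := p 1) (by
    ext i
    simp [mulVec_pencil, h.right_one])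
  intro h0
  apply h.left_one i
  rw [hr, dotProduct_smul, h0, smul_zero]

theorem eval_residual (a b : Fin n → Fin (n + 1) → ℂ) (i : Fin n) (s : ℂ) :
    (residual a b i).eval s = b i ⬝ᵥ minors (pencil a b s 1) := by
  simp [residual, Polynomial.eval_finsetSum, eval_pencilPoly, dotProduct]

/-- On the affine chart the pullback of `a i` is `X` times the residual. Its coefficient of degree
`n` is its value at infinity, which is non-zero. -/
theorem residual_ne_zero_and_natDegree (h : IsGenericFrame L p a b) (i : Fin n) :
    residual a b i ≠ 0 ∧ (residual a b i).natDegree = n - 1 := by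
  have hq : (∑ k, Polynomial.C (a i k) * pencilPoly a b k) = Polynomial.X * residual a b i := by
    refine Polynomial.funext fun s => ?_
    have := dotProduct_minors_pencil a b s 1 i
    rw [Polynomial.eval_mul, eval_residual, Polynomial.eval_X, ← this]
    simp [Polynomial.eval_finsetSum, eval_pencilPoly, dotProduct]
  have hc : (∑ k, Polynomial.C (a i k) * pencilPoly a b k).coeff n ≠ 0 := by
    have := h.left_dot_infty i
    simp only [dotProduct] at this
    simp only [Polynomial.finsetSum_coeff, Polynomial.coeff_C_mul]
    convert this using 3 with k
    rw [← aeval_pencilForms, coeff_aeval_of_isHomogeneous (isHomogeneous_pencilForms a b k),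
      eval_pencilForms]
    rfl
  have hle : (∑ k, Polynomial.C (a i k) * pencilPoly a b k).natDegree ≤ n :=
    Polynomial.natDegree_sum_le_of_forall_le _ _ fun k _ =>
      (Polynomial.natDegree_C_mul_le _ _).trans (natDegree_pencilPoly_le a b k)
  have hdeg := Polynomial.natDegree_eq_of_le_of_coeff_ne_zero hle hc
  have hr : residual a b i ≠ 0 := fun h0 => hc (by rw [hq, h0]; simp)
  rw [hq, Polynomial.natDegree_X_mul hr] at hdeg
  exact ⟨hr, by omega⟩

theorem residual_ne_zero (h : IsGenericFrame L p a b) (i : Fin n) : residual a b i ≠ 0 :=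
  (h.residual_ne_zero_and_natDegree i).1

theorem natDegree_residual (h : IsGenericFrame L p a b) (i : Fin n) :
    (residual a b i).natDegree = n - 1 :=
  (h.residual_ne_zero_and_natDegree i).2

theorem isSecant (h : IsGenericFrame L p a b) (hn : 1 ≤ n) {i : Fin n}
    (hsep : (residual a b i).Separable) :
    IsSecant (curveOf (pencilForms a b)) (L i) := by
  have hst : ∀ s : ℂ, ![s, 1] ≠ 0 := by simp
  have hB := isFormBasis_pencilForms h.det_ne_zero
  let pt : ℂ → ProjSpace n := fun s =>
    Projectivization.mk ℂ (minors (pencil a b s 1)) (h.minors_ne_zero (hst s))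
  have hinj : Function.Injective pt := by
    intro s s' hs
    obtain ⟨r, hr⟩ := (Projectivization.mk_eq_mk_iff' ℂ _ _ _ _).1 hs
    have h1 := curveVec_pencilForms a b ![s, 1]
    have h2 := curveVec_pencilForms a b ![s', 1]
    simp only [Matrix.cons_val_zero, Matrix.cons_val_one] at h1 h2
    have := hB.cross_eq hn (x := ![s, 1]) (y := ![s', 1]) (c := r) (by rw [h1, h2, hr])
    simpa using this
  have himage : (L i).points ∩ curveOf (pencilForms a b) =
      pt '' ((residual a b i).roots.toFinset : Set ℂ) := by
    have hr : residual a b i ≠ 0 := hsep.ne_zero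
    ext P
    simp only [CodimTwo.points, Set.mem_inter_iff, Set.mem_ofPred_eq, Set.mem_image,
      Finset.mem_coe, Multiset.mem_toFinset, Polynomial.mem_roots hr, Polynomial.IsRoot]
    constructor
    · rintro ⟨hPL, x, hx, hv, rfl⟩
      rw [Projectivization.submodule_mk, Submodule.span_singleton_le_iff_mem, h.mem_iff,
        curveVec_pencilForms] at hPL
      -- No intersection point sits at infinity, so the affine chart sees all of them.
      have hx1 : x 1 ≠ 0 := by
        intro hx1
        have hx0 : x 0 ≠ 0 := fun hx0 => hx (by ext i; fin_cases i <;> simp [hx0, hx1])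
        have hxe : x = x 0 • ![1, 0] := by ext i; fin_cases i <;> simp [hx1]
        have h1 := curveVec_smul hB.isHomogeneous (x 0) ![1, 0]
        rw [← hxe, curveVec_pencilForms, curveVec_pencilForms] at h1
        rw [h1, dotProduct_smul, dotProduct_smul] at hPL
        have h2 := hPL.1
        simp only [smul_eq_mul, mul_eq_zero, pow_eq_zero_iff', hx0, false_and, false_or] at h2
        exact h.left_dot_infty i h2
      have hmk : Projectivization.mk ℂ (curveVec (pencilForms a b) x) hv = pt (x 0 / x 1) := by
        refine h.mk_eq_of_mulVec (hst _) hv fun j => ?_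
        have := dotProduct_minors_pencil a b (x 0) (x 1) j
        rw [curveVec_pencilForms]
        field_simp
        linear_combination this
      refine ⟨x 0 / x 1, ?_, hmk.symm⟩
      rw [eval_residual]
      obtain ⟨r, hr'⟩ := (Projectivization.mk_eq_mk_iff' ℂ _ _ _ _).1 hmk.symm
      rw [← hr', curveVec_pencilForms, dotProduct_smul, hPL.2, smul_zero]
    · rintro ⟨s, hs, rfl⟩
      rw [eval_residual] at hs
      refine ⟨?_, h.mk_mem_curveOf (hst s) _ fun j => dotProduct_minors_pencil a b s 1 j⟩
      simp only [pt]
      rw [Projectivization.submodule_mk, Submodule.span_singleton_le_iff_mem, h.mem_iff]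
      refine ⟨?_, hs⟩
      have := dotProduct_minors_pencil a b s 1 i
      rwa [hs, mul_zero, one_mul] at this
  rw [IsSecant, himage, hinj.encard_image, Set.encard_coe_eq_coe_finsetCard,
    Multiset.toFinset_card_of_nodup (Polynomial.nodup_roots hsep),
    ← (IsAlgClosed.splits (residual a b i)).natDegree_eq_card_roots, h.natDegree_residual]

end IsGenericFrame

end Frames

/-! ### Uniqueness by counting zeros -/

section Uniqueness

/-- The determinant of two vectors of the plane. -/
def cross (x y : Fin 2 → ℂ) : ℂ := x 0 * y 1 - y 0 * x 1

/-- The linear form `cross x` as a polynomial. -/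
noncomputable def crossForm (x : Fin 2 → ℂ) : MvPolynomial (Fin 2) ℂ :=
  MvPolynomial.C (x 0) * MvPolynomial.X 1 - MvPolynomial.C (x 1) * MvPolynomial.X 0

theorem eval_crossForm (x y : Fin 2 → ℂ) : MvPolynomial.eval y (crossForm x) = cross x y := by
  simp [crossForm, cross]
  ring

theorem isHomogeneous_crossForm (x : Fin 2 → ℂ) : (crossForm x).IsHomogeneous 1 :=
  (MvPolynomial.isHomogeneous_C_mul_X _ _).sub (MvPolynomial.isHomogeneous_C_mul_X _ _)

variable {n : ℕ}

/-- The pullback of a linear form to a parametrized curve. -/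
noncomputable def pullback (f : Fin (n + 1) → MvPolynomial (Fin 2) ℂ) (l : Fin (n + 1) → ℂ) :
    MvPolynomial (Fin 2) ℂ := ∑ k, MvPolynomial.C (l k) * f k

theorem eval_pullback (f : Fin (n + 1) → MvPolynomial (Fin 2) ℂ) (l : Fin (n + 1) → ℂ)
    (x : Fin 2 → ℂ) : MvPolynomial.eval x (pullback f l) = l ⬝ᵥ curveVec f x := by
  simp [pullback, dotProduct, curveVec]

theorem isHomogeneous_pullback {f : Fin (n + 1) → MvPolynomial (Fin 2) ℂ}
    (hf : ∀ i, (f i).IsHomogeneous n) (l : Fin (n + 1) → ℂ) : (pullback f l).IsHomogeneous n :=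
  MvPolynomial.IsHomogeneous.sum _ _ _ fun k _ => (hf k).C_mul _

theorem IsFormBasis.exists_param {f : Fin (n + 1) → MvPolynomial (Fin 2) ℂ} (hf : IsFormBasis f) :
    ∃ X : ProjSpace n → Fin 2 → ℂ,
      (∀ P ∈ curveOf f, X P ≠ 0 ∧ ∃ h : curveVec f (X P) ≠ 0,
        P = Projectivization.mk ℂ (curveVec f (X P)) h) ∧
      ∀ P ∈ curveOf f, ∀ Q ∈ curveOf f, P ≠ Q → cross (X P) (X Q) ≠ 0 := by
  choose! X hX using fun P (hP : P ∈ curveOf f) => hP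
  refine ⟨X, hX, fun P hP Q hQ hPQ h0 => hPQ ?_⟩
  obtain ⟨hP0, hP1, hP2⟩ := hX P hP
  obtain ⟨hQ0, hQ1, hQ2⟩ := hX Q hQ
  obtain ⟨r, hr⟩ := exists_smul_of_cross_eq hQ0 (sub_eq_zero.1 h0)
  rw [hP2, hQ2, Projectivization.mk_eq_mk_iff']
  exact ⟨r ^ n, by rw [hr, curveVec_smul hf.isHomogeneous]⟩

namespace IsGenericFrame

variable {L : Fin n → CodimTwo n} {p : Fin 3 → Fin (n + 1) → ℂ} {a b : Fin n → Fin (n + 1) → ℂ}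

theorem mk_ne_mk (h : IsGenericFrame L p a b) (hn : 1 ≤ n) (hp : ∀ j, p j ≠ 0) :
    Projectivization.mk ℂ (p 0) (hp 0) ≠ Projectivization.mk ℂ (p 1) (hp 1) ∧
    Projectivization.mk ℂ (p 0) (hp 0) ≠ Projectivization.mk ℂ (p 2) (hp 2) ∧
    Projectivization.mk ℂ (p 1) (hp 1) ≠ Projectivization.mk ℂ (p 2) (hp 2) := by
  let i : Fin n := ⟨0, hn⟩
  refine ⟨fun e => ?_, fun e => ?_, fun e => ?_⟩ <;>
    obtain ⟨r, hr⟩ := (Projectivization.mk_eq_mk_iff' ℂ _ _ _ _).1 e.symm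
  · exact h.left_one i (by rw [← hr, dotProduct_smul, h.left_zero, smul_zero])
  · exact h.left_two i (by rw [← hr, dotProduct_smul, h.left_zero, smul_zero])
  · exact h.left_two i (by rw [← h.right_two, ← hr, dotProduct_smul, h.right_one, smul_zero])

theorem mk_notMem_points (h : IsGenericFrame L p a b) (hp : ∀ j, p j ≠ 0) (i : Fin n) (j : Fin 3) :
    Projectivization.mk ℂ (p j) (hp j) ∉ (L i).points := by
  intro hm
  have hm' : (Projectivization.mk ℂ (p j) (hp j)).submodule ≤ (L i).1 := hm
  rw [Projectivization.submodule_mk, Submodule.span_singleton_le_iff_mem, h.mem_iff] at hm'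
  fin_cases j
  · exact h.right_zero i hm'.2
  · exact h.left_one i hm'.1
  · exact h.left_two i hm'.1

/-- On every curve satisfying the incidence conditions, the pencils induce the same
parametrization. -/
theorem cross_mul_eq (h : IsGenericFrame L p a b) (hn : 1 ≤ n) (hp : ∀ j, p j ≠ 0)
    {f : Fin (n + 1) → MvPolynomial (Fin 2) ℂ} (hf : IsFormBasis f)
    {X : ProjSpace n → Fin 2 → ℂ}
    (hX : ∀ P ∈ curveOf f, X P ≠ 0 ∧ ∃ h : curveVec f (X P) ≠ 0,
        P = Projectivization.mk ℂ (curveVec f (X P)) h)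
    (hcross : ∀ P ∈ curveOf f, ∀ Q ∈ curveOf f, P ≠ Q → cross (X P) (X Q) ≠ 0)
    (hmem : ∀ j, Projectivization.mk ℂ (p j) (hp j) ∈ curveOf f)
    (hsec : ∀ i, IsSecant (curveOf f) (L i))
    {y : Fin 3 → Fin 2 → ℂ} (hy : ∀ j, y j = X (Projectivization.mk ℂ (p j) (hp j)))
    (i : Fin n) (x : Fin 2 → ℂ) :
    cross (y 1) x * cross (y 0) (y 2) * (a i ⬝ᵥ curveVec f x) =
      cross (y 0) x * cross (y 1) (y 2) * (b i ⬝ᵥ curveVec f x) := by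
  classical
  obtain ⟨h01, h02, h12⟩ := h.mk_ne_mk hn hp
  set Q : Fin 3 → ProjSpace n := fun j => Projectivization.mk ℂ (p j) (hp j) with hQ
  have hS := hsec i
  have hfin : ((L i).points ∩ curveOf f).Finite :=
    Set.finite_of_encard_eq_coe (k := n - 1) hS
  let s : Finset (ProjSpace n) := hfin.toFinset ∪ {Q 0, Q 1, Q 2}
  -- The three points lie off `L i`, so they add to the `n - 1` secant points.
  have hscard : s.card = n + 2 := by
    have hc : hfin.toFinset.card = n - 1 := by
      rw [IsSecant, hfin.encard_eq_coe_toFinset_card] at hS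
      exact_mod_cast hS
    rw [Finset.card_union_of_disjoint, hc, Finset.card_eq_three.2 ⟨_, _, _, h01, h02, h12, rfl⟩]
    · omega
    · rw [Finset.disjoint_right]
      intro P hP hP'
      have hP'' : P ∈ (L i).points := ((Set.Finite.mem_toFinset hfin).1 hP').1
      simp only [Finset.mem_insert, Finset.mem_singleton] at hP
      rcases hP with rfl | rfl | rfl <;> exact h.mk_notMem_points hp i _ hP''
  have hsC : ∀ P ∈ s, P ∈ curveOf f := by
    intro P hP
    rcases Finset.mem_union.1 hP with hP | hP
    · exact ((Set.Finite.mem_toFinset hfin).1 hP).2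
    · simp only [Finset.mem_insert, Finset.mem_singleton] at hP
      rcases hP with rfl | rfl | rfl <;> exact hmem _
  have hpt : ∀ j, ∃ r : ℂ, curveVec f (y j) = r • p j := by
    intro j
    obtain ⟨-, h1, h2⟩ := hX _ (hmem j)
    rw [hy]
    obtain ⟨r, hr⟩ := (Projectivization.mk_eq_mk_iff' ℂ _ _ _ _).1 h2.symm
    exact ⟨r, hr.symm⟩
  -- At `y 0` and `y 1` each term has a vanishing factor; the constants `cross (y 0) (y 2)` and
  -- `cross (y 1) (y 2)` make the terms cancel at `y 2`. On `L i` both pullbacks vanish.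
  let G : MvPolynomial (Fin 2) ℂ :=
    crossForm (y 1) * MvPolynomial.C (cross (y 0) (y 2)) * pullback f (a i) -
      crossForm (y 0) * MvPolynomial.C (cross (y 1) (y 2)) * pullback f (b i)
  have hGeval : ∀ z, MvPolynomial.eval z G =
      cross (y 1) z * cross (y 0) (y 2) * (a i ⬝ᵥ curveVec f z) -
        cross (y 0) z * cross (y 1) (y 2) * (b i ⬝ᵥ curveVec f z) := fun z => by
    simp [G, eval_crossForm, eval_pullback]
  have hGhom : G.IsHomogeneous (n + 1) := by
    have key : ∀ u c l, (crossForm u * MvPolynomial.C c * pullback f l).IsHomogeneous (n + 1) := by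
      intro u c l
      have := ((isHomogeneous_crossForm u).mul (MvPolynomial.isHomogeneous_C (Fin 2) c)).mul
        (isHomogeneous_pullback hf.isHomogeneous l)
      rwa [add_zero, add_comm 1 n] at this
    exact (key _ _ _).sub (key _ _ _)
  have hG : G = 0 := by
    refine eq_zero_of_isHomogeneous_of_card hGhom s (by omega) X (fun P hP P' hP' hne => ?_)
      fun P hP => ?_
    · exact sub_ne_zero.1 (hcross P (hsC P hP) P' (hsC P' hP') hne)
    · rw [hGeval]
      rcases Finset.mem_union.1 hP with hP | hP
      · obtain ⟨hPL, hPC⟩ := (Set.Finite.mem_toFinset hfin).1 hP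
        obtain ⟨-, h1, h2⟩ := hX P hPC
        have hPL' : P.submodule ≤ (L i).1 := hPL
        rw [h2, Projectivization.submodule_mk, Submodule.span_singleton_le_iff_mem,
          h.mem_iff] at hPL'
        rw [hPL'.1, hPL'.2]
        ring
      · simp only [Finset.mem_insert, Finset.mem_singleton] at hP
        rcases hP with rfl | rfl | rfl
        · obtain ⟨r, hr⟩ := hpt 0
          rw [← hy, hr, dotProduct_smul, h.left_zero]
          simp [cross]
        · obtain ⟨r, hr⟩ := hpt 1
          rw [← hy, hr, dotProduct_smul, dotProduct_smul, h.right_one]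
          simp [cross]
        · obtain ⟨r, hr⟩ := hpt 2
          rw [← hy, hr, dotProduct_smul, dotProduct_smul, h.right_two]
          ring
  have := hGeval x
  rw [hG, map_zero] at this
  exact (sub_eq_zero.1 this.symm)

/-- By `cross_mul_eq`, the curve vector at `x` is in the kernel of every pencil at a parameter
depending linearly on `x` and not on `i`. This linear map is invertible because `y 0` and `y 1` are
independent, so both inclusions follow. -/
theorem curveOf_eq (h : IsGenericFrame L p a b) (hn : 1 ≤ n) (hp : ∀ j, p j ≠ 0)
    {f : Fin (n + 1) → MvPolynomial (Fin 2) ℂ} (hf : IsFormBasis f)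
    (hmem : ∀ j, Projectivization.mk ℂ (p j) (hp j) ∈ curveOf f)
    (hsec : ∀ i, IsSecant (curveOf f) (L i)) : curveOf f = curveOf (pencilForms a b) := by
  obtain ⟨X, hX, hcross⟩ := hf.exists_param
  obtain ⟨h01, h02, h12⟩ := h.mk_ne_mk hn hp
  set y : Fin 3 → Fin 2 → ℂ := fun j => X (Projectivization.mk ℂ (p j) (hp j)) with hy
  have hkey := h.cross_mul_eq hn hp hf hX hcross hmem hsec (y := y) (fun j => rfl)
  have c01 : cross (y 0) (y 1) ≠ 0 := hcross _ (hmem 0) _ (hmem 1) h01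
  have c02 : cross (y 0) (y 2) ≠ 0 := hcross _ (hmem 0) _ (hmem 2) h02
  have c12 : cross (y 1) (y 2) ≠ 0 := hcross _ (hmem 1) _ (hmem 2) h12
  apply Set.Subset.antisymm
  · rintro _ ⟨x, hx, hv, rfl⟩
    refine h.mk_mem_curveOf (s := cross (y 0) x * cross (y 1) (y 2))
      (t := cross (y 1) x * cross (y 0) (y 2)) (fun h0 => hx ?_) hv fun i => hkey i x
    have e0 : cross (y 0) x = 0 := by simpa [c12] using congrFun h0 0
    have e1 : cross (y 1) x = 0 := by simpa [c02] using congrFun h0 1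
    ext k
    refine (mul_eq_zero.1 (?_ : cross (y 0) (y 1) * x k = 0)).resolve_left c01
    fin_cases k
    · simp only [cross] at *
      simp only [Fin.zero_eta, Fin.isValue]
      linear_combination y 1 0 * e0 - y 0 0 * e1
    · simp only [cross] at *
      simp only [Fin.mk_one, Fin.isValue]
      linear_combination y 1 1 * e0 - y 0 1 * e1
  · rintro _ ⟨z, hz, hv, rfl⟩
    -- Invert the reparametrization: find `x` in the basis `y 0`, `y 1` with prescribed image `z`.
    let β : ℂ := z 0 / (cross (y 0) (y 1) * cross (y 1) (y 2))
    let α : ℂ := -z 1 / (cross (y 0) (y 1) * cross (y 0) (y 2))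
    let x : Fin 2 → ℂ := α • y 0 + β • y 1
    have e0 : cross (y 0) x * cross (y 1) (y 2) = z 0 := by
      have : cross (y 0) x = β * cross (y 0) (y 1) := by
        simp [x, cross]
        ring
      rw [this]
      simp only [β]
      field_simp
    have e1 : cross (y 1) x * cross (y 0) (y 2) = z 1 := by
      have : cross (y 1) x = -α * cross (y 0) (y 1) := by
        simp [x, cross]
        ring
      rw [this]
      simp only [α]
      field_simp
    have hx : x ≠ 0 := by
      intro hx
      apply hz
      rw [hx] at e0 e1
      simp only [cross, Pi.zero_apply, mul_zero, zero_mul, sub_zero] at e0 e1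
      ext k
      fin_cases k
      · exact e0.symm
      · exact e1.symm
    have hz' : ![z 0, z 1] ≠ 0 := by
      intro h0
      exact hz (by ext k; fin_cases k; exacts [congrFun h0 0, congrFun h0 1])
    refine ⟨x, hx, hf.curveVec_ne_zero hx, ?_⟩
    have := h.mk_eq_of_mulVec hz' (hf.curveVec_ne_zero hx) fun i => by
      have := hkey i x
      rwa [e0, e1] at this
    rw [this]
    congr 1
    exact curveVec_pencilForms a b z

theorem existsUnique (h : IsGenericFrame L p a b) (hn : 1 ≤ n) (hp : ∀ j, p j ≠ 0)
    (hsep : ∀ i, (residual a b i).Separable) :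
    ∃! C : Set (ProjSpace n), IsRationalNormalCurve C ∧
      (∀ j, Projectivization.mk ℂ (p j) (hp j) ∈ C) ∧ ∀ i, IsSecant C (L i) := by
  refine ⟨curveOf (pencilForms a b), ⟨(isRationalNormalCurve_iff _).2
    ⟨_, isFormBasis_pencilForms h.det_ne_zero, rfl⟩, h.point_mem hp, fun i => h.isSecant hn (hsep i)⟩, ?_⟩
  rintro C ⟨hC, hmem, hsec⟩
  obtain ⟨f, hf, rfl⟩ := (isRationalNormalCurve_iff C).1 hC
  exact h.curveOf_eq hn hp hf hmem hsec

end IsGenericFrame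

end Uniqueness

/-! ### The genericity polynomial and its independence of coordinates -/

section Coordinates

variable {n : ℕ} {A : Type*} [CommRing A]

/-- The value of the `r`-th equation of the `i`-th linear space at the `j`-th point. -/
def lin (c : Coord n n 3 → A) (i : Fin n) (r : Fin 2) (j : Fin 3) : A :=
  ∑ k, c (Sum.inl (i, r, k)) * c (Sum.inr (j, k))

/-- The determinant of the values of the equations of the `i`-th linear space at two points. -/
def bracket (c : Coord n n 3 → A) (i : Fin n) (j k : Fin 3) : A :=
  lin c i 0 j * lin c i 1 k - lin c i 1 j * lin c i 0 k

/-- The equation of the hyperplane through the `i`-th linear space and the first point. -/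
def leftForm (c : Coord n n 3 → A) (i : Fin n) (m : Fin (n + 1)) : A :=
  bracket c i 1 2 * (lin c i 0 0 * c (Sum.inl (i, 1, m)) - lin c i 1 0 * c (Sum.inl (i, 0, m)))

/-- The equation of the hyperplane through the `i`-th linear space and the second point. -/
def rightForm (c : Coord n n 3 → A) (i : Fin n) (m : Fin (n + 1)) : A :=
  bracket c i 0 2 * (lin c i 0 1 * c (Sum.inl (i, 1, m)) - lin c i 1 1 * c (Sum.inl (i, 0, m)))

/-- The polynomial whose non-vanishing defines generic position. -/
noncomputable def genericity (c : Coord n n 3 → A) : A :=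
  (∏ i, (bracket c i 0 1 * bracket c i 0 2 * bracket c i 1 2)) *
    (coeffMatrix (leftForm c) (rightForm c)).det *
    ∏ i, (residual (leftForm c) (rightForm c) i).resultant
      (Polynomial.derivative (residual (leftForm c) (rightForm c) i)) (n - 1) (n - 1)

theorem map_lin {B : Type*} [CommRing B] (φ : A →+* B) (c : Coord n n 3 → A) (i : Fin n)
    (r : Fin 2) (j : Fin 3) : φ (lin c i r j) = lin (fun x => φ (c x)) i r j := by
  simp [lin]

theorem map_bracket {B : Type*} [CommRing B] (φ : A →+* B) (c : Coord n n 3 → A) (i : Fin n)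
    (j k : Fin 3) : φ (bracket c i j k) = bracket (fun x => φ (c x)) i j k := by
  simp [bracket, map_lin]

theorem map_leftForm {B : Type*} [CommRing B] (φ : A →+* B) (c : Coord n n 3 → A) :
    (fun i m => φ (leftForm c i m)) = leftForm (fun x => φ (c x)) := by
  ext i m
  simp [leftForm, map_lin, map_bracket]

theorem map_rightForm {B : Type*} [CommRing B] (φ : A →+* B) (c : Coord n n 3 → A) :
    (fun i m => φ (rightForm c i m)) = rightForm (fun x => φ (c x)) := by
  ext i m
  simp [rightForm, map_lin, map_bracket]

/-- Naturality identifies the value at `c` of the polynomial built from indeterminates with the same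
expression built from `c`. -/
theorem map_genericity {B : Type*} [CommRing B] (φ : A →+* B) (c : Coord n n 3 → A) :
    φ (genericity c) = genericity (fun x => φ (c x)) := by
  simp only [genericity, map_mul, map_prod, map_bracket, RingHom.map_det,
    RingHom.mapMatrix_apply, map_coeffMatrix, map_leftForm, map_rightForm,
    ← Polynomial.resultant_map_map]
  congr 1
  refine Finset.prod_congr rfl fun i _ => ?_
  rw [← Polynomial.derivative_map, map_residual, map_leftForm, map_rightForm]

/-- Non-vanishing of the genericity polynomial, factor by factor. -/
theorem genericity_ne_zero_iff {c : Coord n n 3 → ℂ} : genericity c ≠ 0 ↔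
    (∀ i, bracket c i 0 1 ≠ 0 ∧ bracket c i 0 2 ≠ 0 ∧ bracket c i 1 2 ≠ 0) ∧
    (coeffMatrix (leftForm c) (rightForm c)).det ≠ 0 ∧
    ∀ i, (residual (leftForm c) (rightForm c) i).resultant
      (Polynomial.derivative (residual (leftForm c) (rightForm c) i)) (n - 1) (n - 1) ≠ 0 := by
  simp only [genericity, mul_ne_zero_iff, Finset.prod_ne_zero_iff, Finset.mem_univ, true_imp_iff,
    and_assoc]

/-- Fixed formal degrees make the resultant commute with ring maps. Overstating the degree of the
derivative costs only a non-zero factor, because `γ` has exact degree `m`. -/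
theorem resultant_derivative_ne_zero_iff {γ : Polynomial ℂ} {m : ℕ} (hγ : γ ≠ 0)
    (hm : γ.natDegree = m) :
    γ.resultant (Polynomial.derivative γ) m m ≠ 0 ↔ γ.Separable := by
  subst hm
  obtain ⟨k, hk⟩ := Nat.exists_eq_add_of_le
    ((Polynomial.natDegree_derivative_le γ).trans (Nat.sub_le _ 1))
  have h1 := Polynomial.resultant_add_right_deg γ (Polynomial.derivative γ) γ.natDegree
    (Polynomial.derivative γ).natDegree k le_rfl
  rw [← hk] at h1
  rw [h1, mul_ne_zero_iff, ne_eq (γ.resultant _), Polynomial.resultant_eq_zero_iff]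
  simp [hγ, Polynomial.Separable]

theorem dotProduct_leftForm (c : Coord n n 3 → A) (i : Fin n) (x : Fin (n + 1) → A) :
    leftForm c i ⬝ᵥ x = bracket c i 1 2 * (lin c i 0 0 * ∑ k, c (Sum.inl (i, 1, k)) * x k -
      lin c i 1 0 * ∑ k, c (Sum.inl (i, 0, k)) * x k) := by
  simp only [dotProduct, leftForm, Finset.mul_sum, ← Finset.sum_sub_distrib]
  exact Finset.sum_congr rfl fun k _ => by ring

theorem dotProduct_rightForm (c : Coord n n 3 → A) (i : Fin n) (x : Fin (n + 1) → A) :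
    rightForm c i ⬝ᵥ x = bracket c i 0 2 * (lin c i 0 1 * ∑ k, c (Sum.inl (i, 1, k)) * x k -
      lin c i 1 1 * ∑ k, c (Sum.inl (i, 0, k)) * x k) := by
  simp only [dotProduct, rightForm, Finset.mul_sum, ← Finset.sum_sub_distrib]
  exact Finset.sum_congr rfl fun k _ => by ring

/-- At point `j` the two forms take the values `bracket 1 2 * bracket 0 j` and `bracket 0 2 *
bracket 1 j`. The leading factors are what make them agree at the third point. -/
theorem isGenericFrame_of_represents {c : Coord n n 3 → ℂ} {δ : Datum n n 3}
    (hδ : Represents c δ) (hc : genericity c ≠ 0) :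
    IsGenericFrame δ.1 (fun j k => c (Sum.inr (j, k))) (leftForm c) (rightForm c) := by
  obtain ⟨hb, hdet, -⟩ := genericity_ne_zero_iff.1 hc
  have hl : ∀ i j, leftForm c i ⬝ᵥ (fun k => c (Sum.inr (j, k))) =
      bracket c i 1 2 * bracket c i 0 j := fun i j => dotProduct_leftForm c i _
  have hr : ∀ i j, rightForm c i ⬝ᵥ (fun k => c (Sum.inr (j, k))) =
      bracket c i 0 2 * bracket c i 1 j := fun i j => dotProduct_rightForm c i _
  refine ⟨fun i x => ?_, fun i => ?_, fun i => ?_, fun i => ?_, fun i => ?_, fun i => ?_,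
    fun i => ?_, hdet⟩
  · obtain ⟨h01, h02, h12⟩ := hb i
    rw [hδ.1 i x, Fin.forall_fin_two, dotProduct_leftForm, dotProduct_rightForm]
    set u := ∑ k, c (Sum.inl (i, 0, k)) * x k
    set v := ∑ k, c (Sum.inl (i, 1, k)) * x k
    constructor
    · rintro ⟨hu, hv⟩
      simp [hu, hv]
    · rintro ⟨h1, h2⟩
      replace h1 := (mul_eq_zero.1 h1).resolve_left h12
      replace h2 := (mul_eq_zero.1 h2).resolve_left h02
      constructor
      · refine (mul_eq_zero.1 (?_ : bracket c i 0 1 * u = 0)).resolve_left h01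
        rw [bracket]
        linear_combination lin c i 0 1 * h1 - lin c i 0 0 * h2
      · refine (mul_eq_zero.1 (?_ : bracket c i 0 1 * v = 0)).resolve_left h01
        rw [bracket]
        linear_combination lin c i 1 1 * h1 - lin c i 1 0 * h2
  · simp only [hl, bracket]
    ring
  · rw [hr]
    refine mul_ne_zero (hb i).2.1 fun h => (hb i).1 ?_
    rw [bracket] at h ⊢
    linear_combination -h
  · rw [hl]
    exact mul_ne_zero (hb i).2.2 (hb i).1
  · simp only [hr, bracket]
    ring
  · rw [hl]
    exact mul_ne_zero (hb i).2.2 (hb i).2.1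
  · rw [hl, hr, mul_comm]

theorem existsUnique_of_represents (hn : 1 ≤ n) {c : Coord n n 3 → ℂ} {δ : Datum n n 3}
    (hδ : Represents c δ) (hc : genericity c ≠ 0) :
    ∃! C : Set (ProjSpace n), IsRationalNormalCurve C ∧ (∀ j, δ.2 j ∈ C) ∧
      ∀ i, IsSecant C (δ.1 i) := by
  have h := isGenericFrame_of_represents hδ hc
  choose hp hδp using hδ.2
  simp only [hδp]
  refine h.existsUnique hn hp fun i => ?_
  have hres := (genericity_ne_zero_iff.1 hc).2.2 i
  exact (resultant_derivative_ne_zero_iff (h.residual_ne_zero i) (h.natDegree_residual i)).1 hres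

/-- Two systems of coordinates of the same datum differ by changes of equations and scalars. -/
theorem Represents.exists_change {c c' : Coord n n 3 → ℂ} {δ : Datum n n 3}
    (h : Represents c δ) (h' : Represents c' δ) :
    ∃ (g : Fin n → Fin 2 → Fin 2 → ℂ) (l : Fin 3 → ℂ),
      (∀ i r k, c (Sum.inl (i, r, k)) =
        g i r 0 * c' (Sum.inl (i, 0, k)) + g i r 1 * c' (Sum.inl (i, 1, k))) ∧
      ∀ j k, c (Sum.inr (j, k)) = l j * c' (Sum.inr (j, k)) := by
  have h1 : ∀ i r, ∃ g : Fin 2 → ℂ, ∀ k, c (Sum.inl (i, r, k)) =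
      g 0 * c' (Sum.inl (i, 0, k)) + g 1 * c' (Sum.inl (i, 1, k)) := by
    intro i r
    let F : (Coord n n 3 → ℂ) → Fin 2 → ((Fin (n + 1) → ℂ) →ₗ[ℂ] ℂ) := fun d s =>
      Fintype.linearCombination ℂ (fun k => d (Sum.inl (i, s, k)))
    have hF : ∀ d s x, F d s x = ∑ k, d (Sum.inl (i, s, k)) * x k := fun d s x => by
      simp [F, Fintype.linearCombination_apply, mul_comm]
    -- A linear form vanishing on the common kernel of finitely many others is in their span.
    have hmem : F c r ∈ Submodule.span ℂ (Set.range (F c')) := by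
      refine mem_span_of_iInf_ker_le_ker fun x hx => ?_
      rw [Submodule.mem_iInf] at hx
      have hx' : x ∈ (δ.1 i).1 := (h'.1 i x).2 fun s => by
        rw [← hF]
        exact hx s
      rw [LinearMap.mem_ker, hF]
      exact (h.1 i x).1 hx' r
    obtain ⟨g, hg⟩ := (Submodule.mem_span_range_iff_exists_fun ℂ).1 hmem
    refine ⟨g, fun k => ?_⟩
    have := LinearMap.congr_fun hg (Pi.single k 1)
    simpa [hF, Fin.sum_univ_two, Pi.single_apply] using this.symm
  have h2 : ∀ j, ∃ l : ℂ, ∀ k, c (Sum.inr (j, k)) = l * c' (Sum.inr (j, k)) := by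
    intro j
    obtain ⟨hv, e⟩ := h.2 j
    obtain ⟨hv', e'⟩ := h'.2 j
    obtain ⟨l, hl⟩ := (Projectivization.mk_eq_mk_iff' ℂ _ _ _ _).1 (e.symm.trans e')
    exact ⟨l, fun k => (congrFun hl k).symm⟩
  choose g hg using h1
  choose l hl using h2
  exact ⟨g, l, hg, hl⟩

/-- Each factor for `c` is a scalar times the corresponding factor for `c'`, so non-vanishing
transfers without checking that the scalars are non-zero. -/
theorem genericity_ne_zero_of_represents {c c' : Coord n n 3 → ℂ} {δ : Datum n n 3}
    (h : Represents c δ) (h' : Represents c' δ) (hc : genericity c ≠ 0) : genericity c' ≠ 0 := by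
  obtain ⟨g, l, hg, hl⟩ := h.exists_change h'
  have hlin : ∀ i r j, lin c i r j = l j * (g i r 0 * lin c' i 0 j + g i r 1 * lin c' i 1 j) := by
    intro i r j
    simp only [lin, hg, hl, Finset.mul_sum, ← Finset.sum_add_distrib]
    exact Finset.sum_congr rfl fun k _ => by ring
  let D : Fin n → ℂ := fun i => g i 0 0 * g i 1 1 - g i 0 1 * g i 1 0
  have hbr : ∀ i j k, bracket c i j k = D i * l j * l k * bracket c' i j k := by
    intro i j k
    simp only [bracket, hlin, D]
    ring
  -- One `D i` comes from the bracket, one from the bracket-like second factor; each `l j` enters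
  -- once. Both forms acquire the same scalar.
  let v : Fin n → ℂ := fun i => D i ^ 2 * (l 0 * l 1 * l 2)
  have hleft : leftForm c = fun i m => v i * leftForm c' i m := by
    ext i m
    simp only [leftForm, hbr, hlin, hg, v, D]
    ring
  have hright : rightForm c = fun i m => v i * rightForm c' i m := by
    ext i m
    simp only [rightForm, hbr, hlin, hg, v, D]
    ring
  rw [genericity_ne_zero_iff] at hc ⊢
  obtain ⟨h1, h2, h3⟩ := hc
  rw [hleft, hright] at h2 h3
  refine ⟨fun i => ?_, ?_, fun i => ?_⟩
  · have := h1 i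
    simp only [hbr] at this
    exact ⟨right_ne_zero_of_mul this.1, right_ne_zero_of_mul this.2.1,
      right_ne_zero_of_mul this.2.2⟩
  · rw [coeffMatrix_mul_rows, Matrix.det_smul] at h2
    exact right_ne_zero_of_mul h2
  · have := h3 i
    rw [residual_mul_rows, Polynomial.derivative_C_mul, Polynomial.resultant_C_mul_left,
      Polynomial.resultant_C_mul_right] at this
    exact right_ne_zero_of_mul (right_ne_zero_of_mul this)

/-- A non-zero bracket makes the two equations independent, so their kernel has codimension exactly
two, and it also excludes zero coordinate vectors for the points. -/
theorem exists_represents (hn : 1 ≤ n) {c : Coord n n 3 → ℂ} (hc : genericity c ≠ 0) :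
    ∃ δ : Datum n n 3, Represents c δ := by
  have hb := (genericity_ne_zero_iff.1 hc).1
  let M : Fin n → Matrix (Fin 2) (Fin (n + 1)) ℂ := fun i =>
    Matrix.of fun r k => c (Sum.inl (i, r, k))
  have hM : ∀ i r x, (M i).mulVecLin x r = ∑ k, c (Sum.inl (i, r, k)) * x k := fun _ _ _ => rfl
  have hsurj : ∀ i, Function.Surjective (M i).mulVecLin := by
    intro i z
    have hD := (hb i).1
    -- Cramer's rule for a preimage of `z` in the span of the first two points.
    refine ⟨((z 0 * lin c i 1 1 - z 1 * lin c i 0 1) / bracket c i 0 1) •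
      (fun k => c (Sum.inr (0, k))) +
      ((lin c i 0 0 * z 1 - lin c i 1 0 * z 0) / bracket c i 0 1) •
      (fun k => c (Sum.inr (1, k))), ?_⟩
    have hlin : ∀ j r, (M i).mulVecLin (fun k => c (Sum.inr (j, k))) r = lin c i r j :=
      fun _ _ => rfl
    rw [map_add, map_smul, map_smul]
    ext r
    simp only [Pi.add_apply, Pi.smul_apply, smul_eq_mul, hlin]
    field_simp
    fin_cases r
    · simp only [bracket, Fin.zero_eta, Fin.isValue]
      ring
    · simp only [bracket, Fin.mk_one, Fin.isValue]
      ring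
  have hrank : ∀ i, Module.finrank ℂ (LinearMap.ker (M i).mulVecLin) + 2 = n + 1 := by
    intro i
    have h1 := LinearMap.finrank_range_add_finrank_ker (M i).mulVecLin
    rw [LinearMap.range_eq_top.2 (hsurj i)] at h1
    simp only [finrank_top, Module.finrank_fin_fun] at h1
    omega
  have hp : ∀ j, (fun k => c (Sum.inr (j, k))) ≠ 0 := by
    intro j h0
    have hj : ∀ k, c (Sum.inr (j, k)) = 0 := fun k => congrFun h0 k
    have hl : ∀ r, lin c ⟨0, hn⟩ r j = 0 := fun r => by simp [lin, hj]
    obtain ⟨h01, h02, -⟩ := hb ⟨0, hn⟩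
    fin_cases j
    · exact h01 (by simp only [Fin.zero_eta] at hl; simp [bracket, hl])
    · exact h01 (by simp only [Fin.mk_one] at hl; simp [bracket, hl])
    · exact h02 (by simp only [Fin.reduceFinMk] at hl; simp [bracket, hl])
  refine ⟨(fun i => ⟨_, hrank i⟩, fun j => Projectivization.mk ℂ _ (hp j)), fun i x => ?_,
    fun j => ⟨hp j, rfl⟩⟩
  simp only [LinearMap.mem_ker]
  rw [funext_iff]
  rfl

end Coordinates

/-! ### A diagonal example with non-vanishing genericity -/

section Example

open Polynomial

variable {n : ℕ}

/-- Left members of the pencils of hyperplanes with base loci `x₀ = xᵢ = 0`. -/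
def diagLeft (l : Fin (n + 1) → ℂ) (i : Fin n) (m : Fin (n + 1)) : ℂ :=
  if m = 0 then l 0 else if m = i.succ then -l i.succ else 0

/-- Right members of the pencils of hyperplanes with base loci `x₀ = xᵢ = 0`. -/
def diagRight (i : Fin n) (m : Fin (n + 1)) : ℂ :=
  if m = 0 then 1 else if m = i.succ then -1 else 0

/-- The pencil equations say that `(X - l k) * x k` is the same for all `k`. The minor for `k = 0`
is a diagonal determinant, and the others follow by cancellation. -/
theorem pencilPoly_diag (l : Fin (n + 1) → ℂ) (k : Fin (n + 1)) :
    pencilPoly (diagLeft l) diagRight k = ∏ j ∈ Finset.univ.erase k, (X - C (l j)) := by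
  have h0 : pencilPoly (diagLeft l) diagRight 0 = ∏ j : Fin n, (X - C (l j.succ)) := by
    rw [pencilPoly, minors, ← Matrix.det_diagonal]
    simp only [Fin.val_zero, pow_zero, one_mul]
    congr 1
    ext1 i j
    by_cases hij : i = j
    · subst hij
      simp [pencil, diagLeft, diagRight]
      ring
    · have : ¬ j = i := fun h => hij h.symm
      simp [pencil, diagLeft, diagRight, hij, this]
  have hall : ∀ k, (X - C (l k)) * ∏ j ∈ Finset.univ.erase k, (X - C (l j)) =
      ∏ j, (X - C (l j)) := fun k =>
    Finset.mul_prod_erase _ (fun j => X - C (l j)) (Finset.mem_univ k)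
  have hp0 : (X - C (l 0)) * pencilPoly (diagLeft l) diagRight 0 = ∏ j, (X - C (l j)) := by
    rw [h0, Fin.prod_univ_succ]
  refine mul_left_cancel₀ (X_sub_C_ne_zero (l k)) ?_
  rw [hall]
  obtain rfl | ⟨i, rfl⟩ := Fin.eq_zero_or_eq_succ k
  · exact hp0
  have h := congrFun (mulVec_minors (pencil (A := ℂ[X]) (fun i k => C (diagLeft l i k))
    (fun i k => C (diagRight i k)) X 1)) i
  rw [Matrix.mulVec, dotProduct, Fin.sum_univ_succ, Finset.sum_eq_single i] at h
  · simp only [pencil, diagLeft, diagRight, Matrix.of_apply, if_true, Fin.succ_ne_zero,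
      if_false, Pi.zero_apply] at h
    rw [← hp0]
    simp only [map_neg, map_one] at h
    change _ * pencilPoly (diagLeft l) diagRight 0 +
      _ * pencilPoly (diagLeft l) diagRight i.succ = 0 at h
    linear_combination h
  · intro j _ hj
    simp [pencil, diagLeft, diagRight, hj]
  · simp

/-- The right form is `x₀ - xᵢ`; the two products share all factors but one, and those differ by a
constant. -/
theorem residual_diag (l : Fin (n + 1) → ℂ) (i : Fin n) :
    residual (diagLeft l) diagRight i =
      C (l 0 - l i.succ) * ∏ j ∈ (Finset.univ.erase 0).erase i.succ, (X - C (l j)) := by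
  have h0 := Finset.mul_prod_erase (Finset.univ.erase 0) (fun j => X - C (l j))
    (Finset.mem_erase.2 ⟨Fin.succ_ne_zero i, Finset.mem_univ _⟩)
  have h1 := Finset.mul_prod_erase (Finset.univ.erase i.succ) (fun j => X - C (l j))
    (Finset.mem_erase.2 ⟨(Fin.succ_ne_zero i).symm, Finset.mem_univ _⟩)
  rw [Finset.erase_right_comm] at h1
  rw [residual, Fin.sum_univ_succ, Finset.sum_eq_single i]
  · simp only [diagRight, if_true, Fin.succ_ne_zero, if_false, pencilPoly_diag, ← h0, ← h1]
    simp only [map_neg, map_one, map_sub]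
    ring
  · intro j _ hj
    simp [diagRight, hj]
  · simp

theorem separable_residual_diag {l : Fin (n + 1) → ℂ} (hl : Function.Injective l) (i : Fin n) :
    (residual (diagLeft l) diagRight i).Separable := by
  have hu : IsUnit (C (l 0 - l i.succ)) := by
    rw [isUnit_C, isUnit_iff_ne_zero, sub_ne_zero]
    exact fun h => Fin.succ_ne_zero i (hl h).symm
  rw [residual_diag]
  exact Separable.unit_mul hu (separable_prod_X_sub_C_iff'.2 fun _ _ _ _ h => hl h)

theorem natDegree_residual_diag {l : Fin (n + 1) → ℂ} (hl : Function.Injective l) (i : Fin n) :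
    (residual (diagLeft l) diagRight i).natDegree = n - 1 := by
  rw [residual_diag, natDegree_C_mul, natDegree_prod_of_monic _ _ fun j _ => monic_X_sub_C _]
  · simp [Finset.card_erase_of_mem, Fin.succ_ne_zero]
  · rw [sub_ne_zero]
    exact fun h => Fin.succ_ne_zero i (hl h).symm

/-- As in Lagrange interpolation, evaluating a linear relation at `l k` leaves only the `k`-th
product. -/
theorem det_coeffMatrix_diag {l : Fin (n + 1) → ℂ} (hl : Function.Injective l) :
    (coeffMatrix (diagLeft l) diagRight).det ≠ 0 := by
  rw [ne_eq, ← Matrix.exists_vecMul_eq_zero_iff]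
  rintro ⟨w, hw, hw0⟩
  have hsum : ∑ k, C (w k) * pencilPoly (diagLeft l) diagRight k = 0 := by
    ext j
    simp only [finsetSum_coeff, coeff_C_mul, coeff_zero]
    by_cases hj : j < n + 1
    · exact congrFun hw0 ⟨j, hj⟩
    · refine Finset.sum_eq_zero fun k _ => ?_
      rw [coeff_eq_zero_of_natDegree_lt, mul_zero]
      have := natDegree_pencilPoly_le (diagLeft l) diagRight k
      omega
  apply hw
  ext k
  have h := congrArg (eval (l k)) hsum
  rw [eval_finsetSum, Finset.sum_eq_single k] at h
  · rw [eval_mul, eval_C, eval_zero, pencilPoly_diag, eval_prod] at h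
    refine (mul_eq_zero.1 h).resolve_right (Finset.prod_ne_zero_iff.2 fun j hj => ?_)
    simp only [eval_sub, eval_X, eval_C, sub_ne_zero]
    exact fun e => Finset.ne_of_mem_erase hj (hl e).symm
  · intro j _ hj
    rw [pencilPoly_diag, eval_mul, eval_prod, Finset.prod_eq_zero (i := k)]
    · simp
    · exact Finset.mem_erase.2 ⟨hj.symm, Finset.mem_univ _⟩
    · simp
  · simp

/-- Coordinates of the linear spaces `x₀ = xᵢ = 0` and of three points on the rational normal curve
`[1 / (s - l₀ t) : ⋯ : 1 / (s - lₙ t)]`. -/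
noncomputable def diagCoord (l : Fin (n + 1) → ℂ) : Coord n n 3 → ℂ
  | Sum.inl (i, r, m) => if m = (![i.succ, 0] : Fin 2 → Fin (n + 1)) r then 1 else 0
  -- The points of the curve at `s/t = 0, ∞, 1`, up to scalars.
  | Sum.inr (j, m) => (![(l m)⁻¹, 1, (1 - l m)⁻¹] : Fin 3 → ℂ) j

theorem lin_diagCoord (l : Fin (n + 1) → ℂ) (i : Fin n) (r : Fin 2) (j : Fin 3) :
    lin (diagCoord l) i r j = diagCoord l (Sum.inr (j, (![i.succ, 0] : Fin 2 → Fin (n + 1)) r)) := by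
  simp [lin, diagCoord]

theorem genericity_diagCoord_ne_zero {l : Fin (n + 1) → ℂ} (hl : Function.Injective l)
    (h0 : ∀ k, l k ≠ 0) (h1 : ∀ k, 1 - l k ≠ 0) : genericity (diagCoord l) ≠ 0 := by
  have hne : ∀ i : Fin n, l 0 - l i.succ ≠ 0 := fun i =>
    sub_ne_zero.2 fun h => Fin.succ_ne_zero i (hl h).symm
  have h01 : ∀ i, bracket (diagCoord l) i 0 1 = (l 0 - l i.succ) / (l 0 * l i.succ) := by
    intro i
    have := h0 0
    have := h0 i.succ
    simp [bracket, lin_diagCoord, diagCoord]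
    field_simp
  have h02 : ∀ i, bracket (diagCoord l) i 0 2 =
      (l 0 - l i.succ) / (l 0 * l i.succ * (1 - l 0) * (1 - l i.succ)) := by
    intro i
    have := h0 0
    have := h0 i.succ
    have := h1 0
    have := h1 i.succ
    simp [bracket, lin_diagCoord, diagCoord]
    field_simp
    ring
  have h12 : ∀ i, bracket (diagCoord l) i 1 2 =
      (l 0 - l i.succ) / ((1 - l 0) * (1 - l i.succ)) := by
    intro i
    have := h1 0
    have := h1 i.succ
    simp [bracket, lin_diagCoord, diagCoord]
    field_simp
    ring
  let v : Fin n → ℂ := fun i => (l 0 - l i.succ) / (l 0 * l i.succ * (1 - l 0) * (1 - l i.succ))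
  have hv : ∀ i, v i ≠ 0 := fun i => div_ne_zero (hne i)
    (mul_ne_zero (mul_ne_zero (mul_ne_zero (h0 _) (h0 _)) (h1 _)) (h1 _))
  have hleft : leftForm (diagCoord l) = fun i m => v i * diagLeft l i m := by
    ext i m
    have := h0 0
    have := h0 i.succ
    have := h1 0
    have := h1 i.succ
    rw [leftForm, h12]
    simp only [lin_diagCoord, diagCoord, diagLeft, v]
    by_cases hm : m = 0
    · subst hm
      simp [(Fin.succ_ne_zero i).symm]
      field_simp
    · by_cases hm' : m = i.succ
      · simp [hm']
        field_simp
      · simp [hm, hm']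
  have hright : rightForm (diagCoord l) = fun i m => v i * diagRight i m := by
    ext i m
    rw [rightForm, h02]
    simp only [lin_diagCoord, diagCoord, diagRight, v]
    by_cases hm : m = 0
    · subst hm
      simp [(Fin.succ_ne_zero i).symm]
    · by_cases hm' : m = i.succ
      · simp [hm']
      · simp [hm, hm']
  rw [genericity_ne_zero_iff, hleft, hright]
  refine ⟨fun i => ⟨?_, ?_, ?_⟩, ?_, fun i => ?_⟩
  · rw [h01]
    exact div_ne_zero (hne i) (mul_ne_zero (h0 _) (h0 _))
  · rw [h02]
    exact hv i
  · rw [h12]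
    exact div_ne_zero (hne i) (mul_ne_zero (h1 _) (h1 _))
  · rw [coeffMatrix_mul_rows, Matrix.det_smul]
    exact mul_ne_zero (pow_ne_zero _ (Finset.prod_ne_zero_iff.2 fun i _ => hv i))
      (det_coeffMatrix_diag hl)
  · have hs : v i * ∏ j, v j ≠ 0 :=
      mul_ne_zero (hv i) (Finset.prod_ne_zero_iff.2 fun i _ => hv i)
    rw [residual_mul_rows, derivative_C_mul, resultant_C_mul_left, resultant_C_mul_right]
    refine mul_ne_zero (pow_ne_zero _ hs) (mul_ne_zero (pow_ne_zero _ hs) ?_)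
    exact (resultant_derivative_ne_zero_iff (separable_residual_diag hl i).ne_zero
      (natDegree_residual_diag hl i)).2 (separable_residual_diag hl i)

theorem exists_genericity_ne_zero (n : ℕ) : ∃ c : Coord n n 3 → ℂ, genericity c ≠ 0 := by
  -- The shift by 2 keeps the nodes away from the parameters 0 and 1.
  refine ⟨diagCoord fun k => (k : ℕ) + 2, genericity_diagCoord_ne_zero ?_ ?_ ?_⟩
  · intro j k h
    simpa [Fin.ext_iff] using h
  · intro k
    exact_mod_cast (by omega : (k : ℕ) + 2 ≠ 0)
  · intro k
    rw [sub_ne_zero]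
    exact_mod_cast (by omega : 1 ≠ (k : ℕ) + 2)

end Example

end RationalNormal

theorem proposition4p4 (n : ℕ) (hn : 1 ≤ n) :
    RationalNormal.HoldsGenerically (fun δ : RationalNormal.Datum n n 3 =>
      ∃! C : Set (RationalNormal.ProjSpace n),
        RationalNormal.IsRationalNormalCurve C ∧
        (∀ j : Fin 3, δ.2 j ∈ C) ∧
        (∀ i : Fin n, RationalNormal.IsSecant C (δ.1 i))) := by
  -- Membership asks for one good system of coordinates; openness holds because then every system is
  -- good.
  refine ⟨{δ | ∃ c, RationalNormal.Represents c δ ∧ RationalNormal.genericity c ≠ 0},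
    ⟨{RationalNormal.genericity MvPolynomial.X}, fun δ c hc => ?_⟩, ?_, ?_⟩
  · have heval : MvPolynomial.eval c (RationalNormal.genericity MvPolynomial.X) =
        RationalNormal.genericity c := by
      rw [RationalNormal.map_genericity]
      simp
    simp only [Set.mem_singleton_iff, exists_eq_left, heval]
    exact ⟨fun ⟨c', hc', h⟩ => RationalNormal.genericity_ne_zero_of_represents hc' hc h,
      fun h => ⟨c, hc, h⟩⟩
  · obtain ⟨c, hc⟩ := RationalNormal.exists_genericity_ne_zero n
    obtain ⟨δ, hδ⟩ := RationalNormal.exists_represents hn hc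
    exact ⟨δ, c, hδ, hc⟩
  · rintro δ ⟨c, hδ, hc⟩
    exact RationalNormal.existsUnique_of_represents hn hδ hc
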